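/- Let $-1<q<1$ and let $\mathcal H$ be a real Hilbert space. Let $\mathcal F_q(\mathcal H)$ be the $q$-Fock space of $\mathcal H$, i.e. the completion of the complex linear span of the vacuum vector $\Phi$ and of the elementary tensors $f_1\otimes\dots\otimes f_n$ ($n\ge 1$, $f_i\in\mathcal H$) in the scalar product $$\langle f_1\otimes\dots\otimes f_n\,|\,g_1\otimes\dots\otimes g_m\rangle_q=\delta_{nm}\sum_{\sigma\in S_n}q^{|\sigma|}\prod_{j=1}^n\langle f_j,g_{\sigma(j)}\rangle ,\qquad |\sigma|=\#\{(i,j): i<j,\ \sigma(i)>\sigma(j)\}.$$ For $f\in\mathcal H$ let $\mathbf a_f^*$ be the bounded operator with $\mathbf a_f^*\Phi=f$, $\mathbf a_f^*\,f_1\otimes\dots\otimes f_n=f\otimes f_1\otimes\dots\otimes f_n$, let $\mathbf a_f$ be its adjoint, i.e. $\mathbf a_f\Phi=0$, $\mathbf a_f\, f_1\otimes\dots\otimes f_n=\sum_{j=1}^n q^{j-1}\langle f,f_j\rangle\, f_1\otimes\dots\otimes f_{j-1}\otimes f_{j+1}\otimes\dots\otimes f_n$, and put $\mathbf X_f=\mathbf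 a_f+\mathbf a_f^*$ and $\mathbb E(\mathbf T)=\langle\Phi|\mathbf T\Phi\rangle_q$. Let $f,g,h\in\mathcal H$ be unit vectors such that $f,h$ are linearly independent. Let $\tilde X,\tilde Y,\tilde Z$ be real random variables on a probability space that form a classical version of the ordered triplet $(\mathbf X_f,\mathbf X_g,\mathbf X_h)$, i.e. for all polynomials $P_1,P_2,P_3$ the random variable $P_1(\tilde X)P_2(\tilde Y)P_3(\tilde Z)$ is integrable and $$\mathbb E\big(P_1(\mathbf X_f)P_2(\mathbf X_g)P_3(\mathbf X_h)\big)=E\big(P_1(\tilde X)P_2(\tilde Y)P_3(\tilde Z)\big).$$ **Theorem.** Almost surely $$E(\tilde Y\mid\tilde X,\tilde Z)=a\tilde X+b\tilde Z,\qquad E(\tilde Y^2\mid\tilde X,\tilde Z)=A\tilde X^2+B\tilde X\tilde Z+C\tilde Z^2+D,$$ where $$a=\frac{\langle f,g\rangle-\langle g,h\rangle\langle f,h\rangle}{1-\langle f,h\rangle^2},\qquad b=\frac{\langle g,h\rangle-\langle f,g\rangle\langle f,h\rangle}{1-\langle f,h\rangle^2},$$ $$A=\frac{ab(1-q)\langle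 f,h\rangle+a^2(1-q\langle f,h\rangle^2)}{1-q\langle f,h\rangle^2},\qquad B=\frac{ab(1+q)(1-\langle f,h\rangle^2)}{1-q\langle f,h\rangle^2},$$ $$C=\frac{ab(1-q)\langle f,h\rangle+b^2(1-q\langle f,h\rangle^2)}{1-q\langle f,h\rangle^2},\qquad D=1-A-B\langle f,h\rangle-C .$$ -/

import Mathlib

open scoped InnerProductSpace ComplexConjugate MeasureTheory

namespace QGauss

/-! ### The algebraic `q`-Fock space and its scalar product -/

/-- An elementary tensor `f₁ ⊗ ⋯ ⊗ fₙ` of vectors of `H`, recorded as `⟨n, (f₁, …, fₙ)⟩`.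
The word of length `0` is the vacuum `Φ`. -/
abbrev Word (H : Type*) := Σ n : ℕ, (Fin n → H)

/-- The number `|σ|` of pairs `i < j` with `σ(i) > σ(j)`. -/
def inversions {n m : ℕ} (σ : Fin n ≃ Fin m) : ℕ :=
  (Finset.univ.filter fun p : Fin n × Fin n => p.1 < p.2 ∧ σ p.2 < σ p.1).card

/-- A finite formal combination of elementary tensors of real vectors with complex
coefficients. Such combinations represent the elements of `ℂ Φ ⊕ ⨁ₙ (H_c)^{⊗ n}`; two of them that
represent the same tensor differ by a vector of `q`-norm zero, and these are
identified in the completion `Fock q H` below. -/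
def PreFock (_q : Set.Ioo (-1 : ℝ) 1) (H : Type*) := Word H →₀ ℂ

noncomputable instance (q : Set.Ioo (-1 : ℝ) 1) (H : Type*) : AddCommGroup (PreFock q H) :=
  inferInstanceAs (AddCommGroup (Word H →₀ ℂ))

noncomputable instance (q : Set.Ioo (-1 : ℝ) 1) (H : Type*) : Module ℂ (PreFock q H) :=
  inferInstanceAs (Module ℂ (Word H →₀ ℂ))

variable {H : Type*} [NormedAddCommGroup H] [InnerProductSpace ℝ H]

/-- `⟨f₁ ⊗ ⋯ ⊗ fₙ | g₁ ⊗ ⋯ ⊗ gₘ⟩_q = ∑_{σ ∈ Sₙ} q^{|σ|} ∏ⱼ ⟨fⱼ, g_{σ(j)}⟩` for `m = n`.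
For `m ≠ n` there are no bijections `σ`, and the sum is `0`. -/
noncomputable def kernel (q : ℝ) (v w : Word H) : ℝ :=
  ∑ σ : Fin v.1 ≃ Fin w.1, q ^ inversions σ * ∏ j, ⟪v.2 j, w.2 (σ j)⟫_ℝ

/-- The sesquilinear extension of `kernel`. -/
noncomputable def form (q : ℝ) (x y : Word H →₀ ℂ) : ℂ :=
  x.sum fun v c => y.sum fun w d => conj c * d * (kernel q v w : ℂ)

lemma inversions_symm {n m : ℕ} (σ : Fin n ≃ Fin m) : inversions σ.symm = inversions σ := by
  unfold inversions
  refine Finset.card_bij' (fun p _ => (σ.symm p.2, σ.symm p.1)) (fun p _ => (σ p.2, σ p.1))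
    ?_ ?_ ?_ ?_ <;> simp +contextual

lemma kernel_symm (q : ℝ) (v w : Word H) : kernel q v w = kernel q w v := by
  unfold kernel
  refine Fintype.sum_equiv (Equiv.symmEquiv _ _) _ _ fun σ => ?_
  change _ = q ^ inversions σ.symm * ∏ j, ⟪w.2 j, v.2 (σ.symm j)⟫_ℝ
  rw [inversions_symm]
  congr 1
  refine Fintype.prod_equiv σ _ _ fun j => ?_
  simp [real_inner_comm]

lemma form_add_left (q : ℝ) (x y z : Word H →₀ ℂ) :
    form q (x + y) z = form q x z + form q y z := by
  unfold form
  rw [Finsupp.sum_add_index'] <;> simp [← Finsupp.sum_add, add_mul]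

lemma form_smul_left (q : ℝ) (c : ℂ) (x y : Word H →₀ ℂ) :
    form q (c • x) y = conj c * form q x y := by
  unfold form
  rw [Finsupp.sum_smul_index] <;> simp [Finsupp.mul_sum, ← mul_assoc]

lemma form_conj_symm (q : ℝ) (x y : Word H →₀ ℂ) : conj (form q y x) = form q x y := by
  unfold form
  simp only [Finsupp.sum, map_sum, map_mul, Complex.conj_conj, Complex.conj_ofReal]
  rw [Finset.sum_comm]
  refine Finset.sum_congr rfl fun v _ => Finset.sum_congr rfl fun w _ => ?_
  rw [kernel_symm q v w]
  ring

/-! ### Positivity of the scalar product -/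

lemma gram_posSemidef {α E : Type*} [NormedAddCommGroup E] [InnerProductSpace ℝ E] (u : α → E) :
    (Matrix.of fun a b => ⟪u a, u b⟫_ℝ : Matrix α α ℝ).PosSemidef := by
  refine ⟨?_, fun x => ?_⟩
  · ext a b
    simp [real_inner_comm]
  · have : (x.sum fun a c => x.sum fun b d =>
        star c * (Matrix.of fun a b => ⟪u a, u b⟫_ℝ : Matrix α α ℝ) a b * d)
        = ⟪x.sum fun a c => c • u a, x.sum fun a c => c • u a⟫_ℝ := by
      simp only [Finsupp.sum, sum_inner, inner_sum, real_inner_smul_left, real_inner_smul_right,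
        Matrix.of_apply, star_trivial]
      refine Finset.sum_congr rfl fun a _ => Finset.sum_congr rfl fun b _ => ?_
      rw [real_inner_comm]
      ring
    rw [this]
    exact real_inner_self_nonneg

lemma hadamard_posSemidef {α : Type*} {A B : Matrix α α ℝ} (hA : A.PosSemidef)
    (hB : B.PosSemidef) : (Matrix.of fun a b => A a b * B a b : Matrix α α ℝ).PosSemidef :=
  Matrix.PosSemidef.hadamard hA hB

lemma prod_posSemidef {α κ : Type*} (s : Finset κ) (M : κ → Matrix α α ℝ)
    (h : ∀ k ∈ s, (M k).PosSemidef) :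
    (Matrix.of fun a b => ∏ k ∈ s, M k a b : Matrix α α ℝ).PosSemidef := by
  classical
  induction s using Finset.induction_on with
  | empty =>
    have := gram_posSemidef (E := ℝ) (fun _ : α => (1 : ℝ))
    simpa using this
  | insert k s hk ih =>
    have := hadamard_posSemidef (h k (by simp)) (ih fun l hl => h l (by simp [hl]))
    simpa [Finset.prod_insert hk] using this

lemma ite_posSemidef {α : Type*} (q : ℝ) (hq : q ∈ Set.Ioo (-1 : ℝ) 1) (p : α → Prop)
    [DecidablePred p] :
    (Matrix.of fun a b => if (p a ↔ p b) then 1 else q : Matrix α α ℝ).PosSemidef := by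
  have h1 := (gram_posSemidef (E := ℝ) (fun _ : α => (1 : ℝ))).smul
    (show (0 : ℝ) ≤ (1 + q) / 2 by linarith [hq.1])
  have h2 := (gram_posSemidef (E := ℝ) (fun a : α => if p a then (1 : ℝ) else -1)).smul
    (show (0 : ℝ) ≤ (1 - q) / 2 by linarith [hq.2])
  convert h1.add h2 using 1
  ext a b
  by_cases ha : p a <;> by_cases hb : p b <;> simp [ha, hb] <;> ring

lemma inversions_eq_card {n : ℕ} (σ ρ : Fin n ≃ Fin n) :
    inversions ρ = ((Finset.univ.filter fun p : Fin n × Fin n => p.1 < p.2).filter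
      fun p => ¬ (σ p.1 < σ p.2 ↔ ρ (σ p.1) < ρ (σ p.2))).card := by
  unfold inversions
  refine Finset.card_bij'
    (fun p _ => if σ.symm p.1 < σ.symm p.2 then (σ.symm p.1, σ.symm p.2)
      else (σ.symm p.2, σ.symm p.1))
    (fun p _ => if σ p.1 < σ p.2 then (σ p.1, σ p.2) else (σ p.2, σ p.1)) ?_ ?_ ?_ ?_
  · rintro ⟨i, j⟩ hp
    simp only [Finset.mem_filter, Finset.mem_univ, true_and] at hp ⊢
    have hne : σ.symm i ≠ σ.symm j := fun h => hp.1.ne (σ.symm.injective h)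
    split_ifs with h
    · simp [h, hp.1, hp.2.le]
    · simp [lt_of_le_of_ne (not_lt.1 h) hne.symm, hp.1.le, hp.2]
  · rintro ⟨i, j⟩ hp
    simp only [Finset.mem_filter, Finset.mem_univ, true_and] at hp ⊢
    have hne : σ i ≠ σ j := fun h => hp.1.ne (σ.injective h)
    have hne' : ρ (σ i) ≠ ρ (σ j) := fun h => hne (ρ.injective h)
    split_ifs with h
    · simp only [h, true_iff, not_lt] at hp
      simp [h, lt_of_le_of_ne hp.2 hne'.symm]
    · simp only [h, false_iff, not_not] at hp
      simp [lt_of_le_of_ne (not_lt.1 h) hne.symm, hp.2]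
  · rintro ⟨i, j⟩ hp
    simp only [Finset.mem_filter, Finset.mem_univ, true_and] at hp
    by_cases h : σ.symm i < σ.symm j
    · simp [h, hp.1]
    · simp [h, hp.1.le]
  · rintro ⟨i, j⟩ hp
    simp only [Finset.mem_filter, Finset.mem_univ, true_and] at hp
    by_cases h : σ i < σ j
    · simp [h, hp.1]
    · simp [h, hp.1.le]

lemma kernel_level_nonneg (q : Set.Ioo (-1 : ℝ) 1) (n : ℕ) (x : (Fin n → H) →₀ ℝ) :
    0 ≤ ∑ F ∈ x.support, ∑ G ∈ x.support, x F * x G * kernel q ⟨n, F⟩ ⟨n, G⟩ := by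
  classical
  let α := (Fin n → H) × (Fin n ≃ Fin n)
  have hM := hadamard_posSemidef
    (prod_posSemidef (α := α) (Finset.univ.filter fun p : Fin n × Fin n => p.1 < p.2)
      (fun p => Matrix.of fun a b =>
        if (a.2 p.1 < a.2 p.2 ↔ b.2 p.1 < b.2 p.2) then 1 else (q : ℝ))
      (fun p _ => ite_posSemidef (q : ℝ) q.2 fun a : α => a.2 p.1 < a.2 p.2))
    (prod_posSemidef (α := α) Finset.univ
      (fun k => Matrix.of fun a b => ⟪a.1 (a.2 k), b.1 (b.2 k)⟫_ℝ)
      (fun k _ => gram_posSemidef fun a : α => a.1 (a.2 k)))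
  have key : ∀ F G : Fin n → H, ∀ σ : (Fin n ≃ Fin n), kernel q ⟨n, F⟩ ⟨n, G⟩ =
      ∑ τ : (Fin n ≃ Fin n),
        (∏ p ∈ Finset.univ.filter fun p : Fin n × Fin n => p.1 < p.2,
          if (σ p.1 < σ p.2 ↔ τ p.1 < τ p.2) then 1 else (q : ℝ)) *
        ∏ k, ⟪F (σ k), G (τ k)⟫_ℝ := by
    intro F G σ
    unfold kernel
    refine Fintype.sum_equiv (σ.symm.equivCongr (Equiv.refl _)) _ _ fun ρ => ?_
    have e : ∀ k, (σ.symm.equivCongr (Equiv.refl _)) ρ k = ρ (σ k) := fun k => rfl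
    simp only [e]
    rw [inversions_eq_card σ ρ, Finset.prod_ite]
    simp only [Finset.prod_const_one, one_mul, Finset.prod_const]
    congr 1
    exact (Fintype.prod_equiv σ _ _ fun k => rfl).symm
  have h := hM.2 (Finsupp.onFinset (x.support ×ˢ Finset.univ) (fun a : α => x a.1)
    (fun a ha => Finset.mem_product.2 ⟨by simpa using ha, Finset.mem_univ _⟩))
  have hcard : 0 < ((Finset.univ : Finset (Fin n ≃ Fin n)).card : ℝ) := by
    exact_mod_cast Finset.card_pos.2 ⟨Equiv.refl _, Finset.mem_univ _⟩
  refine nonneg_of_mul_nonneg_right (a := ((Finset.univ : Finset (Fin n ≃ Fin n)).card : ℝ))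
    ?_ hcard
  refine h.trans_eq ?_
  rw [Finsupp.onFinset_sum _ (by simp), Finset.sum_product, Finset.mul_sum]
  refine Finset.sum_congr rfl fun F _ => ?_
  rw [← nsmul_eq_mul, ← Finset.sum_const]
  refine Finset.sum_congr rfl fun σ _ => ?_
  rw [Finsupp.onFinset_sum _ (by simp), Finset.sum_product]
  refine Finset.sum_congr rfl fun G _ => ?_
  simp only [Matrix.of_apply, star_trivial]
  rw [key F G σ, Finset.mul_sum]
  refine Finset.sum_congr rfl fun τ _ => ?_
  ring

lemma form_self_nonneg (q : Set.Ioo (-1 : ℝ) 1) (x : Word H →₀ ℂ) : 0 ≤ (form q x x).re := by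
  classical
  have hlev : form q x x = ∑ n ∈ x.splitSupport, ∑ F ∈ (x.split n).support,
      ∑ G ∈ (x.split n).support,
        conj (x ⟨n, F⟩) * x ⟨n, G⟩ * (kernel q ⟨n, F⟩ ⟨n, G⟩ : ℂ) := by
    unfold form
    rw [Finsupp.sigma_sum]
    refine Finset.sum_congr rfl fun n hn => Finset.sum_congr rfl fun F _ => ?_
    beta_reduce
    rw [Finsupp.sigma_sum, Finset.sum_eq_single n]
    · rfl
    · intro m _ hmn
      refine Finset.sum_eq_zero fun G _ => ?_
      have : IsEmpty (Fin n ≃ Fin m) := ⟨fun e => hmn (by simpa using (Fintype.card_congr e).symm)⟩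
      simp [kernel]
    · exact fun h => absurd hn h
  rw [hlev, Complex.re_sum]
  refine Finset.sum_nonneg fun n _ => ?_
  have hsub : ∀ y : (Fin n → H) →₀ ℝ, y.support ⊆ (x.split n).support →
      0 ≤ ∑ F ∈ (x.split n).support, ∑ G ∈ (x.split n).support,
        y F * y G * kernel q ⟨n, F⟩ ⟨n, G⟩ := by
    intro y hy
    refine (kernel_level_nonneg q n y).trans_eq ?_
    rw [← Finset.sum_subset hy]
    · refine Finset.sum_congr rfl fun F _ => Finset.sum_subset hy fun G _ hG => ?_
      simp [Finsupp.notMem_support_iff.1 hG]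
    · intro F _ hF
      simp [Finsupp.notMem_support_iff.1 hF]
  have h1 := hsub ((x.split n).mapRange Complex.re rfl) Finsupp.support_mapRange
  have h2 := hsub ((x.split n).mapRange Complex.im rfl) Finsupp.support_mapRange
  refine (add_nonneg h1 h2).trans_eq ?_
  simp only [Complex.re_sum, ← Finset.sum_add_distrib]
  refine Finset.sum_congr rfl fun F _ => Finset.sum_congr rfl fun G _ => ?_
  simp [Finsupp.split_apply]
  ring

/-! ### The `q`-Fock space -/

/-- The scalar product `⟨·|·⟩_q`. -/
noncomputable instance (q : Set.Ioo (-1 : ℝ) 1) : PreInnerProductSpace.Core ℂ (PreFock q H) where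
  inner x y := form q x y
  conj_inner_symm x y := form_conj_symm q x y
  re_inner_nonneg x := form_self_nonneg q x
  add_left x y z := form_add_left q x y z
  smul_left x y c := form_smul_left q c x y

noncomputable instance (q : Set.Ioo (-1 : ℝ) 1) : SeminormedAddCommGroup (PreFock q H) :=
  InnerProductSpace.Core.toSeminormedAddCommGroup (𝕜 := ℂ)

noncomputable instance (q : Set.Ioo (-1 : ℝ) 1) : InnerProductSpace ℂ (PreFock q H) :=
  .ofCore _

/-- The `q`-Fock space: the (separated) completion of `PreFock q H`. -/
def Fock (q : Set.Ioo (-1 : ℝ) 1) (H : Type*) [NormedAddCommGroup H] [InnerProductSpace ℝ H] :=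
  UniformSpace.Completion (PreFock q H)

noncomputable instance (q : Set.Ioo (-1 : ℝ) 1) : NormedAddCommGroup (Fock q H) :=
  inferInstanceAs (NormedAddCommGroup (UniformSpace.Completion (PreFock q H)))

noncomputable instance (q : Set.Ioo (-1 : ℝ) 1) : InnerProductSpace ℂ (Fock q H) :=
  inferInstanceAs (InnerProductSpace ℂ (UniformSpace.Completion (PreFock q H)))

instance (q : Set.Ioo (-1 : ℝ) 1) : CompleteSpace (Fock q H) :=
  inferInstanceAs (CompleteSpace (UniformSpace.Completion (PreFock q H)))

/-- The elementary tensor `f₁ ⊗ ⋯ ⊗ fₙ` as an element of `PreFock q H`. -/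
noncomputable def PreFock.tensor (q : Set.Ioo (-1 : ℝ) 1) (w : Word H) : PreFock q H :=
  Finsupp.single w (1 : ℂ)

/-- The canonical map of `PreFock q H` into its completion. -/
noncomputable def toFock (q : Set.Ioo (-1 : ℝ) 1) (H : Type*) [NormedAddCommGroup H]
    [InnerProductSpace ℝ H] : PreFock q H →ₗ[ℂ] Fock q H :=
  (UniformSpace.Completion.toComplL (𝕜 := ℂ) (E := PreFock q H)).toLinearMap

/-- The vacuum vector `Φ`. -/
noncomputable def vacuum (q : Set.Ioo (-1 : ℝ) 1) (H : Type*) [NormedAddCommGroup H]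
    [InnerProductSpace ℝ H] : Fock q H :=
  toFock q H (PreFock.tensor q ⟨0, Fin.elim0⟩)

/-- Linear extension of a map given on the elementary tensors. -/
noncomputable def PreFock.lift (q : Set.Ioo (-1 : ℝ) 1) {E : Type*} [AddCommGroup E] [Module ℂ E]
    (T : Word H → E) : PreFock q H →ₗ[ℂ] E :=
  Finsupp.linearCombination ℂ T

/-- `a_f^* (f₁ ⊗ ⋯ ⊗ fₙ) = f ⊗ f₁ ⊗ ⋯ ⊗ fₙ` (in particular `a_f^* Φ = f`) on `PreFock q H`. -/
noncomputable def preCreation (q : Set.Ioo (-1 : ℝ) 1) (f : H) : PreFock q H →ₗ[ℂ] PreFock q H :=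
  PreFock.lift q fun w => PreFock.tensor q ⟨w.1 + 1, Fin.cons f w.2⟩

/-- `a_f Φ = 0` and
`a_f (f₁ ⊗ ⋯ ⊗ fₙ) = ∑ⱼ q^{j-1} ⟨f, fⱼ⟩ f₁ ⊗ ⋯ ⊗ f_{j-1} ⊗ f_{j+1} ⊗ ⋯ ⊗ fₙ`
on `PreFock q H`; the index `j` below starts from `0`. -/
noncomputable def preAnnihilation (q : Set.Ioo (-1 : ℝ) 1) (f : H) :
    PreFock q H →ₗ[ℂ] PreFock q H :=
  PreFock.lift q fun w => match w with
    | ⟨0, _⟩ => 0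
    | ⟨n + 1, F⟩ => ∑ j : Fin (n + 1),
        (((q : ℝ) ^ (j : ℕ) * ⟪f, F j⟫_ℝ : ℝ) : ℂ) • PreFock.tensor q ⟨n, j.removeNth F⟩

/-! ### The operators `a_f^*` and `a_f` are bounded and adjoint to each other -/

/-- The bijection `σ` with `σ(0) = j` that is `τ` on the remaining indices. -/
def consPerm {n m : ℕ} (j : Fin (m + 1)) (τ : Fin n ≃ Fin m) : Fin (n + 1) ≃ Fin (m + 1) :=
  (finSuccEquiv n).trans ((Equiv.optionCongr τ).trans (finSuccEquiv' j).symm)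

@[simp] lemma consPerm_zero {n m : ℕ} (j : Fin (m + 1)) (τ : Fin n ≃ Fin m) :
    consPerm j τ 0 = j := by
  simp [consPerm]

@[simp] lemma consPerm_succ {n m : ℕ} (j : Fin (m + 1)) (τ : Fin n ≃ Fin m) (i : Fin n) :
    consPerm j τ i.succ = j.succAbove (τ i) := by
  simp [consPerm]

lemma consPerm_bijective {n m : ℕ} : Function.Bijective
    fun p : Fin (m + 1) × (Fin n ≃ Fin m) => consPerm p.1 p.2 := by
  constructor
  · rintro ⟨j, τ⟩ ⟨j', τ'⟩ h
    have h0 : j = j' := by simpa using DFunLike.congr_fun h 0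
    subst h0
    refine Prod.ext rfl (Equiv.ext fun i => ?_)
    simpa using DFunLike.congr_fun h i.succ
  · intro σ
    have hne : ∀ i : Fin n, σ i.succ ≠ σ 0 := fun i h => Fin.succ_ne_zero i (σ.injective h)
    let e : Option (Fin n) ≃ Option (Fin m) :=
      (finSuccEquiv n).symm.trans (σ.trans (finSuccEquiv' (σ 0)))
    refine ⟨(σ 0, e.removeNone), Equiv.ext fun i => ?_⟩
    refine Fin.cases (by simp) (fun i => ?_) i
    obtain ⟨k, hk⟩ := Fin.exists_succAbove_eq (hne i)
    have hs : e (some i) = some k := by simp [e, ← hk]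
    have := Equiv.removeNone_some e ⟨k, hs⟩
    rw [hs, Option.some_inj] at this
    simp [this, hk]

lemma inversions_eq_sum {n m : ℕ} (σ : Fin n ≃ Fin m) :
    inversions σ = ∑ a, ∑ b, if a < b ∧ σ b < σ a then 1 else 0 := by
  rw [inversions, Finset.card_filter, ← Finset.univ_product_univ, Finset.sum_product]

lemma inversions_consPerm {n m : ℕ} (j : Fin (m + 1)) (τ : Fin n ≃ Fin m) :
    inversions (consPerm j τ) = j + inversions τ := by
  have h : ∀ i : Fin n, j.succAbove (τ i) < j ↔ (τ i).castSucc < j := fun i =>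
    Fin.succAbove_lt_iff_castSucc_lt j (τ i)
  rw [inversions_eq_sum, inversions_eq_sum, Fin.sum_univ_succ]
  congr 1
  · rw [Fin.sum_univ_succ]
    simp only [consPerm_zero, consPerm_succ, h, Fin.succ_pos, lt_irrefl, true_and, false_and,
      if_false, zero_add]
    rw [Fintype.sum_equiv τ _ (fun k : Fin m => if k.castSucc < j then 1 else 0) fun _ => rfl]
    rw [← Finset.card_filter]
    have : (Finset.univ.filter fun k : Fin m => k.castSucc < j).card = (j : ℕ) := by
      have := Fin.card_filter_val_lt (n := m) (m := j)
      simpa [Fin.lt_def, Nat.le_of_lt_succ j.2] using this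
    exact this
  · refine Finset.sum_congr rfl fun a _ => ?_
    rw [Fin.sum_univ_succ]
    simp

lemma kernel_mk (q : ℝ) {n m : ℕ} (F : Fin n → H) (G : Fin m → H) :
    kernel q ⟨n, F⟩ ⟨m, G⟩ =
      ∑ σ : Fin n ≃ Fin m, q ^ inversions σ * ∏ j, ⟪F j, G (σ j)⟫_ℝ := rfl

lemma kernel_cons (q : ℝ) (f : H) {n m : ℕ} (F : Fin n → H) (G : Fin (m + 1) → H) :
    kernel q ⟨n + 1, Fin.cons f F⟩ ⟨m + 1, G⟩ =
      ∑ j : Fin (m + 1), q ^ (j : ℕ) * ⟪f, G j⟫_ℝ * kernel q ⟨n, F⟩ ⟨m, j.removeNth G⟩ := by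
  simp only [kernel_mk, Finset.mul_sum]
  symm
  rw [← Fintype.sum_prod_type']
  refine Fintype.sum_bijective _ consPerm_bijective _ _ fun p => ?_
  rw [inversions_consPerm, Fin.prod_univ_succ]
  simp [Fin.removeNth_apply, pow_add]
  ring

lemma PreFock.lift_tensor (q : Set.Ioo (-1 : ℝ) 1) {V E : Type*} [AddCommGroup E] [Module ℂ E]
    (T : Word V → E) (w : Word V) : PreFock.lift q T (PreFock.tensor q w) = T w := by
  refine (Finsupp.linearCombination_single ℂ (1 : ℂ) w).trans ?_
  rw [one_smul]

@[elab_as_elim]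
lemma PreFock.induction {q : Set.Ioo (-1 : ℝ) 1} {V : Type*} {p : PreFock q V → Prop}
    (x : PreFock q V)
    (zero : p 0) (add : ∀ x y, p x → p y → p (x + y))
    (smul : ∀ (c : ℂ) w, p (c • PreFock.tensor q w)) : p x := by
  refine Finsupp.induction_linear (motive := p) x zero add fun w c => ?_
  have h : (Finsupp.single w c : Word V →₀ ℂ) = c • Finsupp.single w 1 := by simp
  rw [h]
  exact smul c w

lemma inner_tensor (q : Set.Ioo (-1 : ℝ) 1) (v w : Word H) :
    ⟪PreFock.tensor q v, PreFock.tensor q w⟫_ℂ = (kernel q v w : ℂ) := by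
  change form (q : ℝ) (Finsupp.single v 1) (Finsupp.single w 1) = _
  simp [form]

lemma preCreation_tensor (q : Set.Ioo (-1 : ℝ) 1) {V : Type*} (f : V) (w : Word V) :
    preCreation q f (PreFock.tensor q w) = PreFock.tensor q ⟨w.1 + 1, Fin.cons f w.2⟩ :=
  PreFock.lift_tensor q _ w

lemma preAnnihilation_vacuum (q : Set.Ioo (-1 : ℝ) 1) (f : H) (F : Fin 0 → H) :
    preAnnihilation q f (PreFock.tensor q ⟨0, F⟩) = 0 :=
  PreFock.lift_tensor q _ _

lemma preAnnihilation_tensor (q : Set.Ioo (-1 : ℝ) 1) (f : H) {n : ℕ} (F : Fin (n + 1) → H) :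
    preAnnihilation q f (PreFock.tensor q ⟨n + 1, F⟩) = ∑ j : Fin (n + 1),
      (((q : ℝ) ^ (j : ℕ) * ⟪f, F j⟫_ℝ : ℝ) : ℂ) • PreFock.tensor q ⟨n, j.removeNth F⟩ :=
  PreFock.lift_tensor q _ _

lemma inner_preCreation_left (q : Set.Ioo (-1 : ℝ) 1) (f : H) (x y : PreFock q H) :
    ⟪preCreation q f x, y⟫_ℂ = ⟪x, preAnnihilation q f y⟫_ℂ := by
  induction x using PreFock.induction with
  | zero => simp
  | add x x' hx hx' => simp [inner_add_left, hx, hx']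
  | smul c v =>
    induction y using PreFock.induction with
    | zero => simp
    | add y y' hy hy' => simp only [map_add, inner_add_right, hy, hy']
    | smul d w =>
      simp only [map_smul, inner_smul_left, inner_smul_right, preCreation_tensor]
      congr 2
      obtain ⟨n, F⟩ := v
      rcases w with ⟨_ | m, G⟩
      · rw [preAnnihilation_vacuum, inner_zero_right, inner_tensor]
        have : IsEmpty (Fin (n + 1) ≃ Fin 0) := ⟨fun e => (e 0).elim0⟩
        simp [kernel]
      · rw [preAnnihilation_tensor, inner_tensor, kernel_cons, inner_sum]
        simp [inner_smul_right, inner_tensor]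

lemma preAnnihilation_preCreation (q : Set.Ioo (-1 : ℝ) 1) (f g : H) (x : PreFock q H) :
    preAnnihilation q f (preCreation q g x) =
      (⟪f, g⟫_ℝ : ℂ) • x + ((q : ℝ) : ℂ) • preCreation q g (preAnnihilation q f x) := by
  induction x using PreFock.induction with
  | zero => simp
  | add x x' hx hx' => simp only [map_add, smul_add, hx, hx']; abel
  | smul c w =>
    simp only [map_smul, preCreation_tensor]
    rw [smul_comm _ c, smul_comm _ c, ← smul_add]
    congr 1
    obtain ⟨n, F⟩ := w
    rw [preAnnihilation_tensor, Fin.sum_univ_succ]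
    congr 1
    · simp
    · rcases n with _ | n
      · simp [preAnnihilation_vacuum]
      · rw [preAnnihilation_tensor, map_sum, Finset.smul_sum]
        refine Finset.sum_congr rfl fun i _ => ?_
        rw [map_smul, preCreation_tensor, smul_smul, ← Complex.ofReal_mul]
        congr 2
        · simp [pow_succ]
          ring
        · congr 1
          funext k
          refine Fin.cases ?_ (fun k => ?_) k <;> simp [Fin.removeNth_apply]

/-- Combinations of tensors of length at most `N`. -/
noncomputable def levelLE (q : Set.Ioo (-1 : ℝ) 1) (H : Type*) [NormedAddCommGroup H] [InnerProductSpace ℝ H]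
    (N : ℕ) : Submodule ℂ (PreFock q H) :=
  Submodule.span ℂ (PreFock.tensor q '' {w | w.1 ≤ N})

lemma exists_mem_levelLE {q : Set.Ioo (-1 : ℝ) 1} (x : PreFock q H) : ∃ N, x ∈ levelLE q H N := by
  have mono : ∀ {N M : ℕ}, N ≤ M → levelLE q H N ≤ levelLE q H M := fun h =>
    Submodule.span_mono (Set.image_mono fun w hw => le_trans hw h)
  induction x using PreFock.induction with
  | zero => exact ⟨0, Submodule.zero_mem _⟩
  | add x y hx hy =>
    obtain ⟨N, hN⟩ := hx
    obtain ⟨M, hM⟩ := hy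
    exact ⟨max N M, Submodule.add_mem _ (mono (le_max_left _ _) hN) (mono (le_max_right _ _) hM)⟩
  | smul c w => exact ⟨w.1, Submodule.smul_mem _ _ (Submodule.subset_span ⟨w, le_refl w.1, rfl⟩)⟩

lemma preAnnihilation_levelLE_zero {q : Set.Ioo (-1 : ℝ) 1} (f : H) {x : PreFock q H}
    (hx : x ∈ levelLE q H 0) : preAnnihilation q f x = 0 := by
  have : levelLE q H 0 ≤ LinearMap.ker (preAnnihilation q f) := by
    refine Submodule.span_le.2 ?_
    rintro _ ⟨⟨n, F⟩, hn, rfl⟩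
    obtain rfl : n = 0 := Nat.le_zero.1 hn
    exact preAnnihilation_vacuum q f F
  exact this hx

lemma preAnnihilation_levelLE_succ {q : Set.Ioo (-1 : ℝ) 1} (f : H) {N : ℕ} {x : PreFock q H}
    (hx : x ∈ levelLE q H (N + 1)) : preAnnihilation q f x ∈ levelLE q H N := by
  have : levelLE q H (N + 1) ≤ (levelLE q H N).comap (preAnnihilation q f) := by
    refine Submodule.span_le.2 ?_
    rintro _ ⟨⟨n, F⟩, hn, rfl⟩
    rw [SetLike.mem_coe, Submodule.mem_comap]
    rcases n with _ | n
    · rw [preAnnihilation_vacuum]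
      exact Submodule.zero_mem _
    · rw [preAnnihilation_tensor]
      exact Submodule.sum_mem _ fun j _ => Submodule.smul_mem _ _
        (Submodule.subset_span ⟨_, (Nat.le_of_succ_le_succ hn : n ≤ N), rfl⟩)
  exact this hx

/-- The bound `‖f‖ / √(1 - |q|)` for the norms of `a_f^*` and `a_f`. -/
noncomputable def fockBound (q : Set.Ioo (-1 : ℝ) 1) (f : H) : ℝ :=
  √(‖f‖ ^ 2 / (1 - |(q : ℝ)|))

lemma fockBound_sq (q : Set.Ioo (-1 : ℝ) 1) {V : Type*} [NormedAddCommGroup V] (f : V) :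
    fockBound q f ^ 2 = ‖f‖ ^ 2 + |(q : ℝ)| * fockBound q f ^ 2 := by
  have hq : 0 < 1 - |(q : ℝ)| := sub_pos.2 (abs_lt.2 q.2)
  rw [fockBound, Real.sq_sqrt (by positivity)]
  field_simp
  ring

lemma norm_preAnnihilation_le_of {q : Set.Ioo (-1 : ℝ) 1} (f : H) {x : PreFock q H} {C : ℝ}
    (hC : 0 ≤ C) (h : ‖preCreation q f (preAnnihilation q f x)‖ ≤ C * ‖preAnnihilation q f x‖) :
    ‖preAnnihilation q f x‖ ≤ C * ‖x‖ := by
  have h1 : ‖preAnnihilation q f x‖ ^ 2 ≤ C * ‖preAnnihilation q f x‖ * ‖x‖ := by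
    rw [norm_sq_eq_re_inner (𝕜 := ℂ), ← inner_preCreation_left]
    exact (re_inner_le_norm _ _).trans (mul_le_mul_of_nonneg_right h (norm_nonneg _))
  rcases (norm_nonneg (preAnnihilation q f x)).eq_or_lt with h0 | h0
  · rw [← h0]
    positivity
  · refine le_of_mul_le_mul_left ?_ h0
    nlinarith

lemma norm_preCreation_sq (q : Set.Ioo (-1 : ℝ) 1) (f : H) (x : PreFock q H) :
    ‖preCreation q f x‖ ^ 2 = ‖f‖ ^ 2 * ‖x‖ ^ 2 + (q : ℝ) * ‖preAnnihilation q f x‖ ^ 2 := by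
  rw [norm_sq_eq_re_inner (𝕜 := ℂ), inner_preCreation_left, preAnnihilation_preCreation,
    inner_add_right, inner_smul_right, inner_smul_right, ← inner_conj_symm x (preCreation q f _),
    inner_preCreation_left, inner_conj_symm, inner_self_eq_norm_sq_to_K (𝕜 := ℂ) x,
    inner_self_eq_norm_sq_to_K (𝕜 := ℂ) (preAnnihilation q f x), real_inner_self_eq_norm_sq]
  simp only [map_add, RCLike.re_to_complex, Complex.coe_algebraMap, ← Complex.ofReal_pow,
    ← Complex.ofReal_mul, Complex.ofReal_re]

lemma norm_preCreation_le (q : Set.Ioo (-1 : ℝ) 1) (f : H) (x : PreFock q H) :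
    ‖preCreation q f x‖ ≤ fockBound q f * ‖x‖ := by
  have hC : 0 ≤ fockBound q f := Real.sqrt_nonneg _
  obtain ⟨N, hN⟩ := exists_mem_levelLE x
  induction N generalizing x with
  | zero =>
    refine le_of_sq_le_sq ?_ (by positivity)
    rw [norm_preCreation_sq, preAnnihilation_levelLE_zero f hN, mul_pow, fockBound_sq]
    have : 0 ≤ |(q : ℝ)| * fockBound q f ^ 2 * ‖x‖ ^ 2 := by positivity
    simp only [norm_zero]
    linarith
  | succ N ih =>
    have h := norm_preAnnihilation_le_of f hC (ih _ (preAnnihilation_levelLE_succ f hN))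
    have h2 : ‖preAnnihilation q f x‖ ^ 2 ≤ fockBound q f ^ 2 * ‖x‖ ^ 2 := by
      rw [← mul_pow]
      exact pow_le_pow_left₀ (norm_nonneg _) h 2
    refine le_of_sq_le_sq ?_ (by positivity)
    rw [norm_preCreation_sq, mul_pow, fockBound_sq]
    have h3 := mul_le_mul_of_nonneg_left h2 (abs_nonneg (q : ℝ))
    have h4 := mul_le_mul_of_nonneg_right (le_abs_self (q : ℝ))
      (sq_nonneg ‖preAnnihilation q f x‖)
    linarith

lemma norm_preAnnihilation_le (q : Set.Ioo (-1 : ℝ) 1) (f : H) (x : PreFock q H) :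
    ‖preAnnihilation q f x‖ ≤ fockBound q f * ‖x‖ :=
  norm_preAnnihilation_le_of f (Real.sqrt_nonneg _) (norm_preCreation_le q f _)

/-- The creation operator `a_f^*` on the `q`-Fock space: the bounded extension of
`preCreation q f`. -/
noncomputable def creation (q : Set.Ioo (-1 : ℝ) 1) (f : H) : Fock q H →L[ℂ] Fock q H :=
  (toFock q H ∘ₗ preCreation q f).extendOfNorm (toFock q H)

/-- The annihilation operator `a_f` on the `q`-Fock space: the bounded extension of
`preAnnihilation q f`. -/
noncomputable def annihilation (q : Set.Ioo (-1 : ℝ) 1) (f : H) : Fock q H →L[ℂ] Fock q H :=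
  (toFock q H ∘ₗ preAnnihilation q f).extendOfNorm (toFock q H)

lemma denseRange_toFock (q : Set.Ioo (-1 : ℝ) 1) (H : Type*) [NormedAddCommGroup H]
    [InnerProductSpace ℝ H] : DenseRange (toFock q H) :=
  UniformSpace.Completion.denseRange_coe

lemma norm_toFock (q : Set.Ioo (-1 : ℝ) 1) (x : PreFock q H) : ‖toFock q H x‖ = ‖x‖ :=
  UniformSpace.Completion.norm_coe x

lemma inner_toFock (q : Set.Ioo (-1 : ℝ) 1) (x y : PreFock q H) :
    ⟪toFock q H x, toFock q H y⟫_ℂ = ⟪x, y⟫_ℂ :=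
  UniformSpace.Completion.inner_coe x y

lemma creation_toFock (q : Set.Ioo (-1 : ℝ) 1) (f : H) (x : PreFock q H) :
    creation q f (toFock q H x) = toFock q H (preCreation q f x) :=
  LinearMap.extendOfNorm_eq (denseRange_toFock q H)
    ⟨fockBound q f, fun x => by simpa [norm_toFock] using norm_preCreation_le q f x⟩ x

lemma annihilation_toFock (q : Set.Ioo (-1 : ℝ) 1) (f : H) (x : PreFock q H) :
    annihilation q f (toFock q H x) = toFock q H (preAnnihilation q f x) :=
  LinearMap.extendOfNorm_eq (denseRange_toFock q H)
    ⟨fockBound q f, fun x => by simpa [norm_toFock] using norm_preAnnihilation_le q f x⟩ x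

lemma adjoint_creation (q : Set.Ioo (-1 : ℝ) 1) (f : H) :
    ContinuousLinearMap.adjoint (creation q f) = annihilation q f := by
  symm
  rw [ContinuousLinearMap.eq_adjoint_iff]
  have key : ∀ x y : PreFock q H, ⟪annihilation q f (toFock q H x), toFock q H y⟫_ℂ =
      ⟪toFock q H x, creation q f (toFock q H y)⟫_ℂ := by
    intro x y
    rw [annihilation_toFock, creation_toFock, inner_toFock, inner_toFock,
      ← inner_conj_symm, ← inner_preCreation_left, inner_conj_symm]
  intro x y
  refine (denseRange_toFock q H).induction_on₂
    (p := fun x y => ⟪annihilation q f x, y⟫_ℂ = ⟪x, creation q f y⟫_ℂ) ?_ key x y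
  exact isClosed_eq (by fun_prop) (by fun_prop)

/-! ### `q`-Gaussian variables and classical versions -/

/-- The `q`-Gaussian variable `X_f = a_f + a_f^*`. -/
noncomputable def gaussian (q : Set.Ioo (-1 : ℝ) 1) (f : H) : Fock q H →L[ℂ] Fock q H :=
  annihilation q f + creation q f

/-- The vacuum expectation `𝔼(T) = ⟨Φ | T Φ⟩_q`. -/
noncomputable def vacuumExp {q : Set.Ioo (-1 : ℝ) 1} (T : Fock q H →L[ℂ] Fock q H) : ℂ :=
  ⟪vacuum q H, T (vacuum q H)⟫_ℂ

/-- `P(T)` for a polynomial `P` with real coefficients. -/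
noncomputable def polyOf {q : Set.Ioo (-1 : ℝ) 1} (P : Polynomial ℝ)
    (T : Fock q H →L[ℂ] Fock q H) : Fock q H →L[ℂ] Fock q H :=
  Polynomial.aeval T (P.map (algebraMap ℝ ℂ))

/-- The random variables `X, Y, Z` on the probability space `(Ω, μ)` form a classical version of
the ordered triplet `(S, T, U)` of non-commutative random variables:
`𝔼(P₁(S) P₂(T) P₃(U)) = E(P₁(X) P₂(Y) P₃(Z))` for all polynomials `P₁, P₂, P₃`, where the
expectations on the right exist. -/
structure IsClassicalVersion {q : Set.Ioo (-1 : ℝ) 1} (S T U : Fock q H →L[ℂ] Fock q H)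
    {Ω : Type*} [MeasurableSpace Ω] (μ : MeasureTheory.Measure Ω) (X Y Z : Ω → ℝ) : Prop where
  measurable_fst : Measurable X
  measurable_snd : Measurable Y
  measurable_trd : Measurable Z
  integrable : ∀ P₁ P₂ P₃ : Polynomial ℝ,
    MeasureTheory.Integrable (fun ω => P₁.eval (X ω) * P₂.eval (Y ω) * P₃.eval (Z ω)) μ
  moments : ∀ P₁ P₂ P₃ : Polynomial ℝ,
    vacuumExp (polyOf P₁ S * polyOf P₂ T * polyOf P₃ U) =
      ((∫ ω, P₁.eval (X ω) * P₂.eval (Y ω) * P₃.eval (Z ω) ∂μ : ℝ) : ℂ)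

end QGauss

/-! Write `c` for `⟪f, h⟫_ℝ`. By self-adjointness the mixed moment of a middle factor T is ⟨x | T y⟩
with x = X_f^m Φ and y = X_h^n Φ. These vectors lie in the spans of the tensor powers of `f` and of
`h`, and there every annihilator a_k is a multiple of a_f (respectively a_h): ⟨k, f⟩ a_f and ⟨k, h⟩
a_h.

Hence ⟨x | X_k y⟩ depends on k only through ⟨k, f⟩ and ⟨k, h⟩, and ⟨X_k x | X_l y⟩ is a combination
of four fixed inner products, the q-commutation relation supplying the factor q
(`inner_gaussian_gaussian_of_mem_powerSpan`). Replacing X_g by a X_f + b X_h therefore needs two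
scalar equations, and replacing X_g² by A X_f² + B X_f X_h + C X_h² + D needs four; the stated
coefficients solve them. The order f, g, h matters: X_f X_h occurs with X_f on the left, so it
matches a moment of the classical version.

Thus Y - (aX + bZ), and its quadratic analogue, is orthogonal to all monomials X^m Z^n. Passing to
conditional expectations needs density of polynomials: X and Z are almost surely bounded because the
operators are (`ae_abs_le_of_integral_pow_le`), and on a compact square moments determine finite
measures (`measure_ext_of_integral_pow_mul_pow`). Applied to the positive and negative parts of the
difference, this makes its integral vanish on every event of σ(X, Z). -/

namespace QGauss

/-! ### Vacuum moments between tensor powers of two unit vectors -/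

section Fock

variable {H : Type*} [NormedAddCommGroup H] [InnerProductSpace ℝ H] {q : Set.Ioo (-1 : ℝ) 1}

lemma annihilation_vacuum (f : H) : annihilation q f (vacuum q H) = 0 := by
  rw [vacuum, annihilation_toFock, preAnnihilation_vacuum, map_zero]

/-- The `q`-commutation relation `a_f a_g^* = ⟨f, g⟩ + q a_g^* a_f`. -/
lemma annihilation_creation (f g : H) (x : Fock q H) :
    annihilation q f (creation q g x) =
      (⟪f, g⟫_ℝ : ℂ) • x + ((q : ℝ) : ℂ) • creation q g (annihilation q f x) := by
  have : (annihilation q f * creation q g : Fock q H →L[ℂ] Fock q H) =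
      (⟪f, g⟫_ℝ : ℂ) • 1 + ((q : ℝ) : ℂ) • (creation q g * annihilation q f) := by
    refine DFunLike.coe_injective ((denseRange_toFock q H).equalizer
      (ContinuousLinearMap.continuous _) (ContinuousLinearMap.continuous _) (funext fun y => ?_))
    change annihilation q f (creation q g (toFock q H y)) = (⟪f, g⟫_ℝ : ℂ) • toFock q H y +
      ((q : ℝ) : ℂ) • creation q g (annihilation q f (toFock q H y))
    simp only [creation_toFock, annihilation_toFock, preAnnihilation_preCreation, map_add,
      map_smul]
  exact DFunLike.congr_fun this x

lemma inner_creation_left (f : H) (x y : Fock q H) :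
    ⟪creation q f x, y⟫_ℂ = ⟪x, annihilation q f y⟫_ℂ := by
  rw [← adjoint_creation, ContinuousLinearMap.adjoint_inner_right]

lemma inner_creation_right (f : H) (x y : Fock q H) :
    ⟪x, creation q f y⟫_ℂ = ⟪annihilation q f x, y⟫_ℂ := by
  rw [← adjoint_creation, ContinuousLinearMap.adjoint_inner_left]

lemma isSelfAdjoint_gaussian (f : H) : IsSelfAdjoint (gaussian q f) := by
  rw [isSelfAdjoint_iff, ContinuousLinearMap.star_eq_adjoint, gaussian, map_add, adjoint_creation,
    ← adjoint_creation, ContinuousLinearMap.adjoint_adjoint, adjoint_creation, add_comm]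

lemma inner_gaussian_left (f : H) (x y : Fock q H) :
    ⟪gaussian q f x, y⟫_ℂ = ⟪x, gaussian q f y⟫_ℂ := by
  rw [← ContinuousLinearMap.adjoint_inner_right, (isSelfAdjoint_gaussian f).adjoint_eq]

lemma inner_gaussian_pow_left (f : H) (n : ℕ) (x y : Fock q H) :
    ⟪(gaussian q f ^ n) x, y⟫_ℂ = ⟪x, (gaussian q f ^ n) y⟫_ℂ := by
  rw [← ContinuousLinearMap.adjoint_inner_right, ((isSelfAdjoint_gaussian f).pow n).adjoint_eq]

/-- The span of the vectors `Φ, f, f ⊗ f, …`. -/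
noncomputable def powerSpan (q : Set.Ioo (-1 : ℝ) 1) (f : H) : Submodule ℂ (Fock q H) :=
  Submodule.span ℂ (Set.range fun n : ℕ => (creation q f ^ n) (vacuum q H))

lemma creation_pow_vacuum_mem_powerSpan (f : H) (n : ℕ) :
    (creation q f ^ n) (vacuum q H) ∈ powerSpan q f :=
  Submodule.subset_span ⟨n, rfl⟩

lemma vacuum_mem_powerSpan (f : H) : vacuum q H ∈ powerSpan q f :=
  creation_pow_vacuum_mem_powerSpan f 0

lemma creation_mem_powerSpan (f : H) {x : Fock q H} (hx : x ∈ powerSpan q f) :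
    creation q f x ∈ powerSpan q f := by
  have : powerSpan q f ≤ (powerSpan q f).comap (creation q f).toLinearMap := by
    refine Submodule.span_le.2 ?_
    rintro _ ⟨n, rfl⟩
    have := creation_pow_vacuum_mem_powerSpan (q := q) f (n + 1)
    rwa [pow_succ'] at this
  exact this hx

/-- Moving a_k past one a_f^* leaves a scalar multiple of the lower power and q a_f^* a_k, so
induction on the degree closes. -/
lemma annihilation_mem_powerSpan (f k : H) {x : Fock q H} (hx : x ∈ powerSpan q f) :
    annihilation q k x ∈ powerSpan q f := by
  have : powerSpan q f ≤ (powerSpan q f).comap (annihilation q k).toLinearMap := by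
    refine Submodule.span_le.2 ?_
    rintro _ ⟨n, rfl⟩
    change annihilation q k ((creation q f ^ n) (vacuum q H)) ∈ powerSpan q f
    induction n with
    | zero =>
      rw [pow_zero, one_apply_eq_self, annihilation_vacuum]
      exact Submodule.zero_mem _
    | succ n ih =>
      rw [pow_succ', mul_apply_eq_comp, annihilation_creation]
      exact Submodule.add_mem _
        (Submodule.smul_mem _ _ (creation_pow_vacuum_mem_powerSpan f n))
        (Submodule.smul_mem _ _ (creation_mem_powerSpan f ih))
  exact this hx

lemma gaussian_mem_powerSpan (f : H) {x : Fock q H} (hx : x ∈ powerSpan q f) :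
    gaussian q f x ∈ powerSpan q f :=
  Submodule.add_mem _ (annihilation_mem_powerSpan f f hx) (creation_mem_powerSpan f hx)

lemma gaussian_pow_vacuum_mem_powerSpan (f : H) (n : ℕ) :
    (gaussian q f ^ n) (vacuum q H) ∈ powerSpan q f := by
  induction n with
  | zero => exact vacuum_mem_powerSpan f
  | succ n ih =>
    rw [pow_succ']
    exact gaussian_mem_powerSpan f ih

/-- On the span of the powers of a unit vector `f`, `a_k` acts as `⟨k, f⟩ a_f`. -/
lemma annihilation_eq_of_mem_powerSpan {f : H} (hf : ‖f‖ = 1) (k : H) {x : Fock q H}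
    (hx : x ∈ powerSpan q f) :
    annihilation q k x = (⟪k, f⟫_ℝ : ℂ) • annihilation q f x := by
  have : powerSpan q f ≤ LinearMap.eqLocus (annihilation q k).toLinearMap
      ((⟪k, f⟫_ℝ : ℂ) • annihilation q f).toLinearMap := by
    refine Submodule.span_le.2 ?_
    rintro _ ⟨n, rfl⟩
    change annihilation q k ((creation q f ^ n) (vacuum q H)) =
      (⟪k, f⟫_ℝ : ℂ) • annihilation q f ((creation q f ^ n) (vacuum q H))
    induction n with
    | zero => simp [annihilation_vacuum]
    | succ n ih =>
      rw [pow_succ', mul_apply_eq_comp, annihilation_creation, annihilation_creation,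
        ih, real_inner_self_eq_norm_sq, hf, map_smul, smul_add, smul_comm]
      simp
  exact this hx

/-- The creation part of X_k crosses the inner product as a_k. Both halves are then annihilators
acting on powers of one vector, so only two scalars remember k. -/
lemma inner_gaussian_of_mem_powerSpan {f h : H} (hf : ‖f‖ = 1) (hh : ‖h‖ = 1) (k : H)
    {x y : Fock q H} (hx : x ∈ powerSpan q f) (hy : y ∈ powerSpan q h) :
    ⟪x, gaussian q k y⟫_ℂ = (⟪k, f⟫_ℝ : ℂ) * ⟪annihilation q f x, y⟫_ℂ +
      (⟪k, h⟫_ℝ : ℂ) * ⟪x, annihilation q h y⟫_ℂ := by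
  rw [gaussian, add_apply, inner_add_right, inner_creation_right,
    annihilation_eq_of_mem_powerSpan hf k hx, annihilation_eq_of_mem_powerSpan hh k hy,
    inner_smul_left, inner_smul_right, Complex.conj_ofReal, add_comm]

/-- Of the four products of creation and annihilation parts, only ⟨a_k^* x | a_l^* y⟩ = ⟨a_l a_k^* x
| y⟩ needs the commutation relation. It gives the term ⟨k, l⟩⟨x | y⟩ and, with k and l exchanged,
the q-weighted coefficient. -/
lemma inner_gaussian_gaussian_of_mem_powerSpan {f h : H} (hf : ‖f‖ = 1) (hh : ‖h‖ = 1) (k l : H)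
    {x y : Fock q H} (hx : x ∈ powerSpan q f) (hy : y ∈ powerSpan q h) :
    ⟪gaussian q k x, gaussian q l y⟫_ℂ =
      (⟪k, f⟫_ℝ * ⟪l, h⟫_ℝ + (q : ℝ) * (⟪l, f⟫_ℝ * ⟪k, h⟫_ℝ) : ℂ) *
          ⟪annihilation q f x, annihilation q h y⟫_ℂ +
        (⟪k, f⟫_ℝ * ⟪l, f⟫_ℝ : ℂ) * ⟪annihilation q f (annihilation q f x), y⟫_ℂ +
        (⟪k, h⟫_ℝ * ⟪l, h⟫_ℝ : ℂ) * ⟪x, annihilation q h (annihilation q h y)⟫_ℂ +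
        (⟪k, l⟫_ℝ : ℂ) * ⟪x, y⟫_ℂ := by
  have hx' := annihilation_mem_powerSpan f f hx
  have hy' := annihilation_mem_powerSpan h h hy
  simp only [gaussian, add_apply, inner_add_right, inner_add_left,
    inner_creation_right, inner_creation_left]
  rw [annihilation_creation l k x, annihilation_eq_of_mem_powerSpan hf k hx, map_smul,
    annihilation_eq_of_mem_powerSpan hf l hx', annihilation_eq_of_mem_powerSpan hf l hx,
    annihilation_eq_of_mem_powerSpan hh l hy, map_smul,
    annihilation_eq_of_mem_powerSpan hh k hy', inner_add_left, inner_smul_left _ _ ((q : ℝ) : ℂ),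
    inner_creation_left, annihilation_eq_of_mem_powerSpan hh k hy, real_inner_comm k l]
  simp only [inner_smul_left, inner_smul_right, Complex.conj_ofReal]
  ring

/-- The conditional mean identity for the vacuum moments. -/
lemma inner_gaussian_regression {f h : H} (hf : ‖f‖ = 1) (hh : ‖h‖ = 1) (g : H) {a b : ℝ}
    (h1 : ⟪g, f⟫_ℝ = a + b * ⟪f, h⟫_ℝ) (h2 : ⟪g, h⟫_ℝ = a * ⟪f, h⟫_ℝ + b)
    {x y : Fock q H} (hx : x ∈ powerSpan q f) (hy : y ∈ powerSpan q h) :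
    ⟪x, gaussian q g y⟫_ℂ = a * ⟪x, gaussian q f y⟫_ℂ + b * ⟪x, gaussian q h y⟫_ℂ := by
  rw [inner_gaussian_of_mem_powerSpan hf hh g hx hy, inner_gaussian_of_mem_powerSpan hf hh f hx hy,
    inner_gaussian_of_mem_powerSpan hf hh h hx hy, real_inner_self_eq_norm_sq,
    real_inner_self_eq_norm_sq, hf, hh, real_inner_comm f h, h1, h2]
  push_cast
  ring

/-- The conditional second moment identity for the vacuum moments. -/
lemma inner_gaussian_gaussian_regression {f g h : H} (hf : ‖f‖ = 1) (hg : ‖g‖ = 1) (hh : ‖h‖ = 1)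
    {A B C D : ℝ}
    (h1 : ⟪g, f⟫_ℝ ^ 2 = A + B * ⟪f, h⟫_ℝ + C * ⟪f, h⟫_ℝ ^ 2)
    (h2 : ⟪g, h⟫_ℝ ^ 2 = A * ⟪f, h⟫_ℝ ^ 2 + B * ⟪f, h⟫_ℝ + C)
    (h3 : (1 + q) * (⟪g, f⟫_ℝ * ⟪g, h⟫_ℝ) =
      (A + C) * ((1 + q) * ⟪f, h⟫_ℝ) + B * (1 + q * ⟪f, h⟫_ℝ ^ 2))
    (h4 : 1 = A + B * ⟪f, h⟫_ℝ + C + D)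
    {x y : Fock q H} (hx : x ∈ powerSpan q f) (hy : y ∈ powerSpan q h) :
    ⟪gaussian q g x, gaussian q g y⟫_ℂ = A * ⟪gaussian q f x, gaussian q f y⟫_ℂ +
      B * ⟪gaussian q f x, gaussian q h y⟫_ℂ + C * ⟪gaussian q h x, gaussian q h y⟫_ℂ +
      D * ⟪x, y⟫_ℂ := by
  simp only [inner_gaussian_gaussian_of_mem_powerSpan hf hh _ _ hx hy, real_inner_self_eq_norm_sq,
    hf, hg, hh, real_inner_comm f h]
  have e1 := congrArg Complex.ofReal h1
  have e2 := congrArg Complex.ofReal h2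
  have e3 := congrArg Complex.ofReal h3
  have e4 := congrArg Complex.ofReal h4
  push_cast at e1 e2 e3 e4 ⊢
  -- Each scalar hypothesis compares the coefficients of one of the four inner products, so it is
  -- multiplied by that inner product.
  linear_combination ⟪annihilation q f (annihilation q f x), y⟫_ℂ * e1 +
    ⟪x, annihilation q h (annihilation q h y)⟫_ℂ * e2 +
    ⟪annihilation q f x, annihilation q h y⟫_ℂ * e3 + ⟪x, y⟫_ℂ * e4

lemma polyOf_X_pow (n : ℕ) (T : Fock q H →L[ℂ] Fock q H) :
    polyOf (Polynomial.X ^ n) T = T ^ n := by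
  simp [polyOf]

lemma norm_vacuum : ‖vacuum q H‖ = 1 := by
  have h : ⟪vacuum q H, vacuum q H⟫_ℂ = 1 := by
    rw [vacuum, inner_toFock, inner_tensor]
    simp [kernel, inversions]
  rw [inner_self_eq_norm_sq_to_K] at h
  have h' : ‖vacuum q H‖ ^ 2 = 1 := by
    apply Complex.ofReal_injective
    push_cast
    exact h
  exact (pow_eq_one_iff_of_nonneg (norm_nonneg _) two_ne_zero).1 h'

/-! ### Orthogonality to monomials for the classical version -/

namespace IsClassicalVersion

variable {f g h : H} {Ω : Type*} [MeasurableSpace Ω] {μ : MeasureTheory.Measure Ω}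
  {X Y Z : Ω → ℝ}

lemma integrable_pow {S T U : Fock q H →L[ℂ] Fock q H} (hv : IsClassicalVersion S T U μ X Y Z)
    (m k n : ℕ) : MeasureTheory.Integrable (fun ω => X ω ^ m * Y ω ^ k * Z ω ^ n) μ := by
  simpa using hv.integrable (Polynomial.X ^ m) (Polynomial.X ^ k) (Polynomial.X ^ n)

/-- Moving X_f^m to the left slot places the two outer factors in `powerSpan q f` and `powerSpan q
h`, with X_g^k between them. -/
lemma integral_pow
    (hv : IsClassicalVersion (gaussian q f) (gaussian q g) (gaussian q h) μ X Y Z) (m k n : ℕ) :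
    ((∫ ω, X ω ^ m * Y ω ^ k * Z ω ^ n ∂μ : ℝ) : ℂ) =
      ⟪(gaussian q f ^ m) (vacuum q H),
        (gaussian q g ^ k) ((gaussian q h ^ n) (vacuum q H))⟫_ℂ := by
  have := hv.moments (Polynomial.X ^ m) (Polynomial.X ^ k) (Polynomial.X ^ n)
  simp only [polyOf_X_pow, Polynomial.eval_pow, Polynomial.eval_X] at this
  rw [← this, vacuumExp, inner_gaussian_pow_left]
  rfl

lemma integral_regression
    (hv : IsClassicalVersion (gaussian q f) (gaussian q g) (gaussian q h) μ X Y Z)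
    (hf : ‖f‖ = 1) (hh : ‖h‖ = 1) {a b : ℝ}
    (h1 : ⟪g, f⟫_ℝ = a + b * ⟪f, h⟫_ℝ) (h2 : ⟪g, h⟫_ℝ = a * ⟪f, h⟫_ℝ + b) (m n : ℕ) :
    ∫ ω, (Y ω - (a * X ω + b * Z ω)) * (X ω ^ m * Z ω ^ n) ∂μ = 0 := by
  have e := inner_gaussian_regression (q := q) hf hh g h1 h2
    (gaussian_pow_vacuum_mem_powerSpan f m) (gaussian_pow_vacuum_mem_powerSpan h n)
  have e1 := hv.integral_pow m 1 n
  have e2 := hv.integral_pow (m + 1) 0 n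
  have e3 := hv.integral_pow m 0 (n + 1)
  have i1 := hv.integrable_pow m 1 n
  have i2 := (hv.integrable_pow (m + 1) 0 n).const_mul a
  have i3 := (hv.integrable_pow m 0 (n + 1)).const_mul b
  -- The extra X_f belongs to the middle operator, so it is moved back to the right slot.
  rw [pow_succ', mul_apply_eq_comp, inner_gaussian_left] at e2
  rw [pow_succ' (gaussian q h), mul_apply_eq_comp] at e3
  rw [pow_one] at e1
  simp only [pow_zero, one_apply_eq_self] at e2 e3
  rw [← e1, ← e2, ← e3] at e
  simp only [← Complex.ofReal_mul, ← Complex.ofReal_add, Complex.ofReal_inj] at e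
  have : ∀ ω, (Y ω - (a * X ω + b * Z ω)) * (X ω ^ m * Z ω ^ n) = X ω ^ m * Y ω ^ 1 * Z ω ^ n -
      (a * (X ω ^ (m + 1) * Y ω ^ 0 * Z ω ^ n) + b * (X ω ^ m * Y ω ^ 0 * Z ω ^ (n + 1))) := by
    intro ω
    ring
  simp only [this]
  rw [MeasureTheory.integral_sub i1 (i2.fun_add i3), MeasureTheory.integral_add i2 i3,
    MeasureTheory.integral_const_mul, MeasureTheory.integral_const_mul, e]
  simp

lemma integral_sq_regression
    (hv : IsClassicalVersion (gaussian q f) (gaussian q g) (gaussian q h) μ X Y Z)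
    (hf : ‖f‖ = 1) (hg : ‖g‖ = 1) (hh : ‖h‖ = 1) {A B C D : ℝ}
    (h1 : ⟪g, f⟫_ℝ ^ 2 = A + B * ⟪f, h⟫_ℝ + C * ⟪f, h⟫_ℝ ^ 2)
    (h2 : ⟪g, h⟫_ℝ ^ 2 = A * ⟪f, h⟫_ℝ ^ 2 + B * ⟪f, h⟫_ℝ + C)
    (h3 : (1 + q) * (⟪g, f⟫_ℝ * ⟪g, h⟫_ℝ) =
      (A + C) * ((1 + q) * ⟪f, h⟫_ℝ) + B * (1 + q * ⟪f, h⟫_ℝ ^ 2))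
    (h4 : 1 = A + B * ⟪f, h⟫_ℝ + C + D) (m n : ℕ) :
    ∫ ω, (Y ω ^ 2 - (A * X ω ^ 2 + B * (X ω * Z ω) + C * Z ω ^ 2 + D)) *
      (X ω ^ m * Z ω ^ n) ∂μ = 0 := by
  have e := inner_gaussian_gaussian_regression (q := q) hf hg hh h1 h2 h3 h4
    (gaussian_pow_vacuum_mem_powerSpan f m) (gaussian_pow_vacuum_mem_powerSpan h n)
  have e1 := hv.integral_pow m 2 n
  have e2 := hv.integral_pow (m + 2) 0 n
  have e3 := hv.integral_pow (m + 1) 0 (n + 1)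
  have e4 := hv.integral_pow m 0 (n + 2)
  have e5 := hv.integral_pow m 0 n
  have i1 := hv.integrable_pow m 2 n
  have i2 := (hv.integrable_pow (m + 2) 0 n).const_mul A
  have i3 := (hv.integrable_pow (m + 1) 0 (n + 1)).const_mul B
  have i4 := (hv.integrable_pow m 0 (n + 2)).const_mul C
  have i5 := (hv.integrable_pow m 0 n).const_mul D
  simp only [pow_succ', mul_apply_eq_comp, pow_zero, mul_one] at e1
  simp only [pow_succ' (gaussian q f), pow_succ' (gaussian q h), mul_apply_eq_comp, pow_zero,
    one_apply_eq_self] at e2 e3 e4 e5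
  -- The two middle factors are split, one on each side; the mixed moment `e3` already has this
  -- form.
  rw [← inner_gaussian_left] at e1 e4
  rw [inner_gaussian_left f (gaussian q f _)] at e2
  rw [← e2, ← e3, ← e4, ← e5, ← e1] at e
  simp only [← Complex.ofReal_mul, ← Complex.ofReal_add, Complex.ofReal_inj] at e
  have : ∀ ω, (Y ω ^ 2 - (A * X ω ^ 2 + B * (X ω * Z ω) + C * Z ω ^ 2 + D)) *
      (X ω ^ m * Z ω ^ n) = X ω ^ m * Y ω ^ 2 * Z ω ^ n -
      (A * (X ω ^ (m + 2) * Y ω ^ 0 * Z ω ^ n) + B * (X ω ^ (m + 1) * Y ω ^ 0 * Z ω ^ (n + 1)) +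
        C * (X ω ^ m * Y ω ^ 0 * Z ω ^ (n + 2)) + D * (X ω ^ m * Y ω ^ 0 * Z ω ^ n)) := by
    intro ω
    ring
  simp only [this]
  rw [MeasureTheory.integral_sub i1 (((i2.fun_add i3).fun_add i4).fun_add i5),
    MeasureTheory.integral_add ((i2.fun_add i3).fun_add i4) i5,
    MeasureTheory.integral_add (i2.fun_add i3) i4, MeasureTheory.integral_add i2 i3]
  simp only [MeasureTheory.integral_const_mul, sq, e]
  simp

end IsClassicalVersion

end Fock

end QGauss

/-! ### Determinacy of moments on a square -/

open MeasureTheory BoundedContinuousFunction in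
/-- A finite measure on a square is determined by its moments. -/
lemma measure_ext_of_integral_pow_mul_pow {M : ℝ}
    {P P' : Measure (Set.Icc (-M) M × Set.Icc (-M) M)} [IsFiniteMeasure P] [IsFiniteMeasure P']
    (h : ∀ m n : ℕ, ∫ x, (x.1 : ℝ) ^ m * (x.2 : ℝ) ^ n ∂P = ∫ x, (x.1 : ℝ) ^ m * (x.2 : ℝ) ^ n ∂P') :
    P = P' := by
  let K := Set.Icc (-M) M × Set.Icc (-M) M
  let u : K →ᵇ ℝ := mkOfCompact ⟨fun x : Set.Icc (-M) M × Set.Icc (-M) M => (x.1 : ℝ), by fun_prop⟩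
  let v : K →ᵇ ℝ := mkOfCompact ⟨fun x : Set.Icc (-M) M × Set.Icc (-M) M => (x.2 : ℝ), by fun_prop⟩
  let A : StarSubalgebra ℝ (K →ᵇ ℝ) :=
    { Algebra.adjoin ℝ {u, v} with
      star_mem' := fun {a} ha => by rwa [show star a = a from ext fun _ => by simp] }
  have hu : u ∈ A := Algebra.subset_adjoin (by simp)
  have hv : v ∈ A := Algebra.subset_adjoin (by simp)
  -- A point-separating algebra of bounded continuous functions determines a finite measure; the two
  -- coordinates separate points.
  refine ext_of_forall_mem_subalgebra_integral_eq_of_polish (𝕜 := ℝ) (A := A) ?_ fun g hg => ?_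
  · intro x y hxy
    by_cases h1 : x.1 = y.1
    · have h2 : (x.2 : ℝ) ≠ y.2 := fun h2 => hxy (Prod.ext h1 (Subtype.ext h2))
      exact ⟨v, ⟨_, ⟨v, hv, rfl⟩, rfl⟩, h2⟩
    · have h2 : (x.1 : ℝ) ≠ y.1 := fun h2 => h1 (Subtype.ext h2)
      exact ⟨u, ⟨_, ⟨u, hu, rfl⟩, rfl⟩, h2⟩
  -- The algebra is the linear span of the monomials in `u` and `v`, so linearity reduces the claim
  -- to the moments.
  · have hA : ∀ x ∈ Submodule.span ℝ (Submonoid.closure {u, v} : Set (K →ᵇ ℝ)), x ∈ A := by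
      rw [← Algebra.adjoin_eq_span]
      exact fun x hx => hx
    have hg' : g ∈ Submodule.span ℝ (Submonoid.closure {u, v} : Set (K →ᵇ ℝ)) := by
      rw [← Algebra.adjoin_eq_span]
      exact hg
    induction hg' using Submodule.span_induction with
    | mem x hx =>
      obtain ⟨m, n, rfl⟩ := (Submonoid.mem_closure_pair _ _ _).1 hx
      exact h m n
    | zero => simp
    | add x y hx hy ihx ihy =>
      simp only [coe_add, Pi.add_apply]
      rw [integral_add (x.integrable _) (y.integrable _),
        integral_add (x.integrable _) (y.integrable _), ihx (hA x hx), ihy (hA y hy)]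
    | smul c x hx ih =>
      simp only [coe_smul]
      rw [integral_smul, integral_smul, ih (hA x hx)]

/-! ### From orthogonality to conditional expectation; boundedness from moments -/

section Moments

open MeasureTheory

variable {Ω : Type*} [MeasurableSpace Ω] {μ : Measure Ω} {X Z W : Ω → ℝ}

/-- `ENNReal.ofReal` truncates at zero, so this measure is the image of the positive part of the
signed measure `W μ`. The negative part comes from `-W`. -/
lemma integral_map_withDensity_ofReal {E : Type*} [MeasurableSpace E] (hW : AEMeasurable W μ)
    {φ : Ω → E} (hφ : Measurable φ) {F : E → ℝ} (hF : Measurable F) :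
    ∫ x, F x ∂((μ.withDensity fun ω => ENNReal.ofReal (W ω)).map φ) =
      ∫ ω, max (W ω) 0 * F (φ ω) ∂μ := by
  rw [integral_map hφ.aemeasurable hF.aestronglyMeasurable,
    integral_withDensity_eq_integral_toReal_smul₀ hW.ennreal_ofReal
      (ae_of_all _ fun _ => ENNReal.ofReal_lt_top)]
  simp [ENNReal.toReal_ofReal']

/-- An integrable variable that is orthogonal to all monomials in two bounded variables has zero
integral over all events determined by these two variables. -/
lemma setIntegral_preimage_eq_zero_of_integral_mul_pow (hX : Measurable X) (hZ : Measurable Z)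
    (hW : Integrable W μ) {M : ℝ} (hM : 0 ≤ M) (hXM : ∀ᵐ ω ∂μ, |X ω| ≤ M)
    (hZM : ∀ᵐ ω ∂μ, |Z ω| ≤ M) (h : ∀ m n : ℕ, ∫ ω, W ω * (X ω ^ m * Z ω ^ n) ∂μ = 0)
    {T : Set (ℝ × ℝ)} (hT : MeasurableSet T) :
    ∫ ω in (fun ω => (X ω, Z ω)) ⁻¹' T, W ω ∂μ = 0 := by
  have hM' : -M ≤ M := by linarith
  -- Clamping makes the pair take values in the compact square everywhere; it changes the pair only
  -- on a null set.
  let φ : Ω → Set.Icc (-M) M × Set.Icc (-M) M :=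
    fun ω => (Set.projIcc (-M) M hM' (X ω), Set.projIcc (-M) M hM' (Z ω))
  have hφ : Measurable φ :=
    (continuous_projIcc.measurable.comp hX).prodMk (continuous_projIcc.measurable.comp hZ)
  have hXφ : ∀ᵐ ω ∂μ, (((φ ω).1 : ℝ), ((φ ω).2 : ℝ)) = (X ω, Z ω) := by
    filter_upwards [hXM, hZM] with ω h1 h2
    simp only [φ, Set.projIcc_of_mem hM' (abs_le.1 h1), Set.projIcc_of_mem hM' (abs_le.1 h2)]
  have key : ∀ F : Set.Icc (-M) M × Set.Icc (-M) M → ℝ, Measurable F → (∃ C, ∀ x, |F x| ≤ C) →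
      (∫ ω, W ω * F (φ ω) ∂μ) =
      (∫ x, F x ∂((μ.withDensity fun ω => ENNReal.ofReal (W ω)).map φ)) -
      ∫ x, F x ∂((μ.withDensity fun ω => ENNReal.ofReal (-W ω)).map φ) := by
    rintro F hF ⟨C, hC⟩
    rw [integral_map_withDensity_ofReal hW.1.aemeasurable hφ hF,
      integral_map_withDensity_ofReal (W := fun ω => -W ω) hW.neg.1.aemeasurable hφ hF,
      ← integral_sub]
    · refine integral_congr_ae (ae_of_all _ fun ω => ?_)
      simp only
      rw [← sub_mul, max_zero_sub_max_neg_zero_eq_self]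
    · exact hW.pos_part.mul_bdd (c := C) (hF.comp hφ).aestronglyMeasurable
        (ae_of_all _ fun ω => hC _)
    · exact hW.neg.pos_part.mul_bdd (c := C) (hF.comp hφ).aestronglyMeasurable
        (ae_of_all _ fun ω => hC _)
  have := isFiniteMeasure_withDensity_ofReal hW.2
  have := isFiniteMeasure_withDensity_ofReal hW.neg.2
  -- The moments of the two measures differ by ∫ W X^m Z^n, which is zero by `h`.
  have hP : (μ.withDensity fun ω => ENNReal.ofReal (W ω)).map φ =
      (μ.withDensity fun ω => ENNReal.ofReal (-W ω)).map φ := by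
    refine measure_ext_of_integral_pow_mul_pow fun m n => ?_
    rw [← sub_eq_zero, ← key _ (by fun_prop), ← h m n]
    · refine integral_congr_ae ?_
      filter_upwards [hXφ] with ω hω
      rw [Prod.mk.injEq] at hω
      rw [hω.1, hω.2]
    · refine ⟨M ^ m * M ^ n, fun x => ?_⟩
      rw [abs_mul, abs_pow, abs_pow]
      have h1 := abs_le.2 x.1.2
      have h2 := abs_le.2 x.2.2
      gcongr
  rw [← integral_indicator ((hX.prodMk hZ) hT)]
  have hT' : Measurable fun x : Set.Icc (-M) M × Set.Icc (-M) M =>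
      T.indicator (fun _ => (1 : ℝ)) ((x.1 : ℝ), (x.2 : ℝ)) :=
    (measurable_const.indicator hT).comp (by fun_prop)
  -- Equality of the measures now allows the test function to be the indicator of `T`.
  have := key _ hT' ⟨1, fun x => by
    by_cases hx : ((x.1 : ℝ), (x.2 : ℝ)) ∈ T <;> simp [hx]⟩
  rw [hP, sub_self] at this
  rw [← this]
  refine integral_congr_ae ?_
  filter_upwards [hXφ] with ω hω
  rw [hω]
  by_cases hx : (X ω, Z ω) ∈ T <;> simp [hx]

lemma condExp_eq_of_integral_mul_pow [IsFiniteMeasure μ] (hX : Measurable X) (hZ : Measurable Z)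
    {M : ℝ} (hM : 0 ≤ M) (hXM : ∀ᵐ ω ∂μ, |X ω| ≤ M) (hZM : ∀ᵐ ω ∂μ, |Z ω| ≤ M)
    (hW : Integrable W μ) {G : ℝ × ℝ → ℝ} (hG : Measurable G)
    (hGi : Integrable (fun ω => G (X ω, Z ω)) μ)
    (h : ∀ m n : ℕ, ∫ ω, (W ω - G (X ω, Z ω)) * (X ω ^ m * Z ω ^ n) ∂μ = 0) :
    μ[W | MeasurableSpace.comap (fun ω => (X ω, Z ω)) inferInstance]
      =ᵐ[μ] fun ω => G (X ω, Z ω) := by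
  symm
  refine ae_eq_condExp_of_forall_setIntegral_eq (hX.prodMk hZ).comap_le hW
    (fun _ _ _ => hGi.integrableOn) ?_
    (hG.comp (comap_measurable _)).stronglyMeasurable.aestronglyMeasurable
  rintro _ ⟨T, hT, rfl⟩ -
  have := setIntegral_preimage_eq_zero_of_integral_mul_pow hX hZ (hW.sub hGi) hM hXM hZM h hT
  simp only [Pi.sub_apply] at this
  rw [integral_sub hW.integrableOn hGi.integrableOn, sub_eq_zero] at this
  exact this.symm

/-- A variable with geometrically growing even moments is bounded. -/
lemma ae_abs_le_of_integral_pow_le [IsFiniteMeasure μ] {M : ℝ} (hM : 0 ≤ M)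
    (hi : ∀ n, Integrable (fun ω => X ω ^ n) μ) (h : ∀ n : ℕ, ∫ ω, X ω ^ (2 * n) ∂μ ≤ M ^ (2 * n)) :
    ∀ᵐ ω ∂μ, |X ω| ≤ M + 1 := by
  have hpos : 0 < M + 1 := by linarith
  -- Markov's inequality for X^(2n). The margin 1 makes the ratio M / (M + 1) less than one, also
  -- for M = 0, and n is then sent to infinity.
  have hb : ∀ n : ℕ, μ.real {ω | M + 1 ≤ |X ω|} ≤ ((M / (M + 1)) ^ 2) ^ n := by
    intro n
    have h1 := mul_meas_ge_le_integral_of_nonneg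
      (ae_of_all μ fun ω => (even_two_mul n).pow_nonneg (X ω)) (hi (2 * n)) ((M + 1) ^ (2 * n))
    have h2 : μ.real {ω | M + 1 ≤ |X ω|} ≤ μ.real {ω | (M + 1) ^ (2 * n) ≤ X ω ^ (2 * n)} := by
      refine measureReal_mono fun ω hω => ?_
      rw [Set.mem_ofPred_eq, ← (even_two_mul n).pow_abs (X ω)]
      exact pow_le_pow_left₀ hpos.le hω _
    rw [← pow_mul, div_pow, le_div_iff₀ (by positivity), mul_comm]
    exact (mul_le_mul_of_nonneg_left h2 (by positivity)).trans (h1.trans (h n))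
  have hlt : (M / (M + 1)) ^ 2 < 1 :=
    pow_lt_one₀ (by positivity) ((div_lt_one hpos).2 (by linarith)) two_ne_zero
  have h0 : μ.real {ω | M + 1 ≤ |X ω|} = 0 := le_antisymm
    (ge_of_tendsto' (tendsto_pow_atTop_nhds_zero_of_lt_one (by positivity) hlt) hb)
    measureReal_nonneg
  rw [measureReal_eq_zero_iff] at h0
  refine Filter.mem_of_superset (measure_eq_zero_iff_ae_notMem.1 h0) fun ω hω => ?_
  exact (not_le.1 (show ¬ M + 1 ≤ |X ω| from hω)).le

end Moments

/-! ### Boundedness of the classical variables -/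

namespace QGauss

section

variable {H : Type*} [NormedAddCommGroup H] [InnerProductSpace ℝ H] {q : Set.Ioo (-1 : ℝ) 1}

lemma norm_inner_vacuum_pow_le (T : Fock q H →L[ℂ] Fock q H) (n : ℕ) :
    ‖⟪vacuum q H, (T ^ n) (vacuum q H)⟫_ℂ‖ ≤ ‖T‖ ^ n := by
  refine (norm_inner_le_norm _ _).trans ?_
  rw [norm_vacuum, one_mul]
  induction n with
  | zero => simp [norm_vacuum]
  | succ n ih =>
    rw [pow_succ', mul_apply_eq_comp, pow_succ']
    exact (T.le_opNorm _).trans (mul_le_mul_of_nonneg_left ih (norm_nonneg _))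

namespace IsClassicalVersion

variable {f g h : H} {Ω : Type*} [MeasurableSpace Ω] {μ : MeasureTheory.Measure Ω}
  {X Y Z : Ω → ℝ}

/-- The moments of `X` are vacuum moments of a bounded operator, hence at most powers of its norm.
-/
lemma ae_abs_fst_le [MeasureTheory.IsFiniteMeasure μ]
    (hv : IsClassicalVersion (gaussian q f) (gaussian q g) (gaussian q h) μ X Y Z) :
    ∀ᵐ ω ∂μ, |X ω| ≤ ‖gaussian q f‖ + 1 := by
  refine ae_abs_le_of_integral_pow_le (norm_nonneg _)
    (fun n => by simpa using hv.integrable_pow n 0 0) fun n => ?_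
  have h1 := hv.integral_pow (2 * n) 0 0
  simp only [pow_zero, one_apply_eq_self, mul_one, inner_gaussian_pow_left] at h1
  have h2 := norm_inner_vacuum_pow_le (gaussian q f) (2 * n)
  rw [← h1, Complex.norm_real] at h2
  exact (le_abs_self _).trans h2

lemma ae_abs_trd_le [MeasureTheory.IsFiniteMeasure μ]
    (hv : IsClassicalVersion (gaussian q f) (gaussian q g) (gaussian q h) μ X Y Z) :
    ∀ᵐ ω ∂μ, |Z ω| ≤ ‖gaussian q h‖ + 1 := by
  refine ae_abs_le_of_integral_pow_le (norm_nonneg _)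
    (fun n => by simpa using hv.integrable_pow 0 0 n) fun n => ?_
  have h1 := hv.integral_pow 0 0 (2 * n)
  simp only [pow_zero, one_apply_eq_self, one_mul] at h1
  have h2 := norm_inner_vacuum_pow_le (gaussian q h) (2 * n)
  rw [← h1, Complex.norm_real] at h2
  exact (le_abs_self _).trans h2

end IsClassicalVersion

end

/-- Equality in Cauchy–Schwarz would force f = h or f = -h. -/
lemma inner_sq_lt_one {H : Type*} [NormedAddCommGroup H] [InnerProductSpace ℝ H] {f h : H}
    (hf : ‖f‖ = 1) (hh : ‖h‖ = 1) (hfh : LinearIndependent ℝ ![f, h]) : ⟪f, h⟫_ℝ ^ 2 < 1 := by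
  rw [LinearIndependent.pair_iff] at hfh
  rw [sq_lt_one_iff_abs_lt_one]
  refine lt_of_le_of_ne ((abs_real_inner_le_norm f h).trans_eq (by simp [hf, hh])) fun hc => ?_
  rcases eq_or_eq_neg_of_abs_eq hc with hc | hc
  · have := (inner_eq_one_iff_of_norm_eq_one hf hh).1 hc
    simpa using hfh 1 (-1) (by simp [this])
  · have := (inner_eq_neg_one_iff_of_norm_eq_one hf hh).1 hc
    simpa using hfh 1 1 (by simp [this])

end QGauss

/-! ### Solving for the coefficients -/

theorem mainTheorem2 {H : Type*} [NormedAddCommGroup H] [InnerProductSpace ℝ H] [CompleteSpace H]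
    (q : Set.Ioo (-1 : ℝ) 1) (f g h : H) (hf : ‖f‖ = 1) (hg : ‖g‖ = 1) (hh : ‖h‖ = 1)
    (hfh : LinearIndependent ℝ ![f, h])
    {Ω : Type*} [MeasurableSpace Ω] (μ : MeasureTheory.Measure Ω)
    [MeasureTheory.IsProbabilityMeasure μ] (X Y Z : Ω → ℝ)
    (hXYZ : QGauss.IsClassicalVersion (QGauss.gaussian q f) (QGauss.gaussian q g)
      (QGauss.gaussian q h) μ X Y Z)
    (a b A B C D : ℝ)
    (ha : a = (⟪f, g⟫_ℝ - ⟪g, h⟫_ℝ * ⟪f, h⟫_ℝ) / (1 - ⟪f, h⟫_ℝ ^ 2))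
    (hb : b = (⟪g, h⟫_ℝ - ⟪f, g⟫_ℝ * ⟪f, h⟫_ℝ) / (1 - ⟪f, h⟫_ℝ ^ 2))
    (hA : A = (a * b * (1 - q) * ⟪f, h⟫_ℝ + a ^ 2 * (1 - q * ⟪f, h⟫_ℝ ^ 2)) /
      (1 - q * ⟪f, h⟫_ℝ ^ 2))
    (hB : B = a * b * (1 + q) * (1 - ⟪f, h⟫_ℝ ^ 2) / (1 - q * ⟪f, h⟫_ℝ ^ 2))
    (hC : C = (a * b * (1 - q) * ⟪f, h⟫_ℝ + b ^ 2 * (1 - q * ⟪f, h⟫_ℝ ^ 2)) /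
      (1 - q * ⟪f, h⟫_ℝ ^ 2))
    (hD : D = 1 - A - B * ⟪f, h⟫_ℝ - C) :
    μ[Y | MeasurableSpace.comap (fun ω => (X ω, Z ω)) inferInstance]
        =ᵐ[μ] (fun ω => a * X ω + b * Z ω) ∧
      μ[fun ω => Y ω ^ 2 | MeasurableSpace.comap (fun ω => (X ω, Z ω)) inferInstance]
        =ᵐ[μ] (fun ω => A * X ω ^ 2 + B * (X ω * Z ω) + C * Z ω ^ 2 + D) := by
  have hc := QGauss.inner_sq_lt_one hf hh hfh
  set c := ⟪f, h⟫_ℝ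
  have hc1 : 1 - c ^ 2 ≠ 0 := by linarith
  have hc2 : 1 - q * c ^ 2 ≠ 0 := by
    have : (q : ℝ) * c ^ 2 < 1 := by nlinarith [q.2.1, q.2.2, sq_nonneg c]
    linarith
  -- `h1` and `h2` are the normal equations: a f + b h is the orthogonal projection of `g` onto the
  -- span of `f` and `h`.
  have h1 : ⟪g, f⟫_ℝ = a + b * c := by
    rw [real_inner_comm, ha, hb]
    field_simp
    ring
  have h2 : ⟪g, h⟫_ℝ = a * c + b := by
    rw [ha, hb]
    field_simp
    ring
  have dA := (eq_div_iff hc2).1 hA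
  have dB := (eq_div_iff hc2).1 hB
  have dC := (eq_div_iff hc2).1 hC
  -- Once the inner products with `g` are written through `a`, `b`, `c` and the denominator 1 - q c²
  -- is cleared, `s1`, `s2` and `s3` are polynomial identities.
  have s1 : ⟪g, f⟫_ℝ ^ 2 = A + B * c + C * c ^ 2 := by
    refine mul_right_cancel₀ hc2 ?_
    rw [h1]
    linear_combination -dA - c * dB - c ^ 2 * dC
  have s2 : ⟪g, h⟫_ℝ ^ 2 = A * c ^ 2 + B * c + C := by
    refine mul_right_cancel₀ hc2 ?_
    rw [h2]
    linear_combination -c ^ 2 * dA - c * dB - dC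
  have s3 : (1 + q) * (⟪g, f⟫_ℝ * ⟪g, h⟫_ℝ) = (A + C) * ((1 + q) * c) + B * (1 + q * c ^ 2) := by
    refine mul_right_cancel₀ hc2 ?_
    rw [h1, h2]
    linear_combination -(1 + q) * c * (dA + dC) - (1 + q * c ^ 2) * dB
  have s4 : 1 = A + B * c + C + D := by
    rw [hD]
    ring
  have iX : MeasureTheory.Integrable X μ := by simpa using hXYZ.integrable_pow 1 0 0
  have iZ : MeasureTheory.Integrable Z μ := by simpa using hXYZ.integrable_pow 0 0 1
  have iX2 : MeasureTheory.Integrable (fun ω => X ω ^ 2) μ := by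
    simpa using hXYZ.integrable_pow 2 0 0
  have iZ2 : MeasureTheory.Integrable (fun ω => Z ω ^ 2) μ := by
    simpa using hXYZ.integrable_pow 0 0 2
  have iXZ : MeasureTheory.Integrable (fun ω => X ω * Z ω) μ := by
    simpa using hXYZ.integrable_pow 1 0 1
  -- Both variables need one common bound, since the moment argument runs on a square.
  have hX := hXYZ.ae_abs_fst_le.mono fun ω hω =>
    hω.trans (le_max_left _ (‖QGauss.gaussian q h‖ + 1))
  have hZ := hXYZ.ae_abs_trd_le.mono fun ω hω =>
    hω.trans (le_max_right (‖QGauss.gaussian q f‖ + 1) _)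
  have hM : 0 ≤ max (‖QGauss.gaussian q f‖ + 1) (‖QGauss.gaussian q h‖ + 1) :=
    le_max_of_le_left (by positivity)
  constructor
  · exact condExp_eq_of_integral_mul_pow (G := fun x => a * x.1 + b * x.2) hXYZ.measurable_fst
      hXYZ.measurable_trd hM hX hZ (by simpa using hXYZ.integrable_pow 0 1 0) (by fun_prop)
      ((iX.const_mul a).add (iZ.const_mul b)) (hXYZ.integral_regression hf hh h1 h2)
  · exact condExp_eq_of_integral_mul_pow
      (G := fun x => A * x.1 ^ 2 + B * (x.1 * x.2) + C * x.2 ^ 2 + D) hXYZ.measurable_fst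
      hXYZ.measurable_trd hM hX hZ (by simpa using hXYZ.integrable_pow 0 2 0) (by fun_prop)
      ((((iX2.const_mul A).add (iXZ.const_mul B)).add (iZ2.const_mul C)).add
        (MeasureTheory.integrable_const D)) (hXYZ.integral_sq_regression hf hg hh s1 s2 s3 s4)
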